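/- Let $f_1,\dots,f_n:\mathbb{R}^p\to\mathbb{R}$ be quadratic functions, $f=\frac1n\sum_{i=1}^n f_i$, let $\mathcal C\subseteq\mathbb{R}^p$ be closed and convex, and let $\theta_*\in\mathcal C$ minimize $f$ over $\mathcal C$. Let $K$ satisfy $\|\nabla^2 f_i(\theta)\|_2\le K$ for all $i$ and all $\theta\in\mathcal C$, and let $k>0$ satisfy $\nabla^2 f(\theta_*)\succeq k I$. At each iteration $t$ let $S_t$ be a uniformly random sample of $|S_t|\ge 1$ indices from $[n]$, drawn with or without replacement, the samples of different iterations being independent (scheme S1). Let $0\le r<p$ be the rank threshold. NewSamp starts at $\hat\theta^0\in\mathbb{R}^p$ and iterates $$\hat\theta^{t+1}=\mathcal P_{\mathcal C}\big(\hat\theta^t-\eta_t\mathbf Q^t\nabla f(\hat\theta^t)\big),\qquad \mathbf Q^t=(\lambda^t_{r+1})^{-1}I+\sum_{i\le r}\big((\lambda_i^t)^{-1}-(\lambda_{r+1}^t)^{-1}\big)u_iu_i^T ,$$ where $\mathcal P_{\mathcal C}$ is the Euclidean projection onto $\mathcal C$, $\lambda^t_1\ge\dots\ge\lambda^t_p$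 are the eigenvalues of $\mathbf H_{S_t}(\hat\theta^t)=\frac1{|S_t|}\sum_{i\in S_t}\nabla^2 f_i(\hat\theta^t)$ (repeated indices counted with multiplicity), and $u_1,\dots,u_p$ are corresponding orthonormal eigenvectors. Let $\lambda_1^*\ge\dots\ge\lambda_p^*$ be the eigenvalues of $\nabla^2 f(\theta_*)$. For an absolute constant $c>0$ put $$\xi_1^t=1-\eta_t\frac{\lambda_p^t}{\lambda_{r+1}^t}+\eta_t\frac{cK}{\lambda_{r+1}^t}\sqrt{\frac{\log p}{|S_t|}},\qquad \xi_1^*=1-\eta_t\frac{\lambda_p^*}{\lambda_{r+1}^*}+\eta_t\frac{cK}{\lambda_{r+1}^*}\sqrt{\frac{\log p}{|S_t|}} .$$ For every $c>0$ there are constants $c_1,c_2>0$, depending on nothing but $c$, such that whenever $\eta_t=1$ and $|S_t|$ is sufficiently large, namely so large that $c_2K\sqrt{\log p/|S_t|}<k$, with probability at least $1-2/p$ $$|\xi_1^t-\xi_1^*|\le\frac{c_1K^2\sqrt{\log p/|S_t|}}{k\big(k-c_2K\sqrt{\log p/|S_t|}\big)} .$$ -/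

import Mathlib

namespace NewSamp

/-- The parameter space `ℝ^p` with the Euclidean norm. -/
abbrev Param (p : ℕ) : Type := EuclideanSpace ℝ (Fin p)

/-- A quadratic function `θ ↦ ½ ⟨Aθ, θ⟩ + ⟨b, θ⟩ + d` with `A` self-adjoint. -/
def IsQuadratic {p : ℕ} (g : Param p → ℝ) : Prop :=
  ∃ (A : Param p →L[ℝ] Param p) (b : Param p) (d : ℝ), IsSelfAdjoint A ∧
    ∀ θ, g θ = (1 / 2) * inner ℝ (A θ) θ + inner ℝ b θ + d

/-- The Hessian at `θ`, as an operator: the derivative of the gradient. Its norm is the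
spectral norm of the Hessian matrix. -/
noncomputable def hessian {p : ℕ} (g : Param p → ℝ) (θ : Param p) : Param p →L[ℝ] Param p :=
  fderiv ℝ (gradient g) θ

/-- The objective: the average `f = (1/n) ∑ f_i`. -/
noncomputable def objective {p n : ℕ} (f : Fin n → Param p → ℝ) (θ : Param p) : ℝ :=
  (1 / (n : ℝ)) * ∑ i, f i θ

/-- The sub-sampled Hessian `H_S(θ) = (1/|S|) ∑_{i ∈ S} ∇² f_i(θ)`. The sample is listed as
`s 0, …, s (m-1)`, where `m = |S|` (entries repeat only in sampling with replacement). -/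
noncomputable def subHessian {p n m : ℕ} (f : Fin n → Param p → ℝ) (s : Fin m → Fin n)
    (θ : Param p) : Param p →L[ℝ] Param p :=
  (1 / (m : ℝ)) • ∑ j, hessian (f (s j)) θ

open Classical in
/-- The `j`-th largest eigenvalue (`1 ≤ j ≤ p`, counted with multiplicity) of a symmetric
operator; `0` outside this range. -/
noncomputable def eigval {p : ℕ} (T : Param p →L[ℝ] Param p) (j : ℕ) : ℝ :=
  if h : (T : Param p →ₗ[ℝ] Param p).IsSymmetric ∧ 1 ≤ j ∧ j ≤ p then
    h.1.eigenvalues finrank_euclideanSpace_fin ⟨j - 1, by omega⟩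
  else 0

open Classical in
/-- A unit eigenvector for the `j`-th largest eigenvalue (`1 ≤ j ≤ p`); together they form an
orthonormal basis. -/
noncomputable def eigvec {p : ℕ} (T : Param p →L[ℝ] Param p) (j : ℕ) : Param p :=
  if h : (T : Param p →ₗ[ℝ] Param p).IsSymmetric ∧ 1 ≤ j ∧ j ≤ p then
    h.1.eigenvectorBasis finrank_euclideanSpace_fin ⟨j - 1, by omega⟩
  else 0

/-- The scaling matrix `Q = λ_{r+1}⁻¹ I + U_r (Λ_r⁻¹ - λ_{r+1}⁻¹ I) U_rᵀ` built from the `r + 1`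
largest eigenvalues and the `r` leading eigenvectors of `T`. -/
noncomputable def scaling {p : ℕ} (r : ℕ) (T : Param p →L[ℝ] Param p) (v : Param p) : Param p :=
  (eigval T (r + 1))⁻¹ • v +
    ∑ i ∈ Finset.Icc 1 r,
      (((eigval T i)⁻¹ - (eigval T (r + 1))⁻¹) * inner ℝ (eigvec T i) v) • eigvec T i

open Classical in
/-- Euclidean projection onto `C`: a point of `C` nearest to `x` (unique if `C` is nonempty,
closed and convex). -/
noncomputable def proj {p : ℕ} (C : Set (Param p)) (x : Param p) : Param p :=
  if h : ∃ y ∈ C, ∀ z ∈ C, ‖x - y‖ ≤ ‖x - z‖ then h.choose else x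

/-- The NewSamp iterates `θ̂^t` for initial point `θ₀`, rank threshold `r`, step sizes `η` and
samples `s 0, s 1, …` of sizes `m 0, m 1, …`. -/
noncomputable def iterate {p n : ℕ} (f : Fin n → Param p → ℝ) (C : Set (Param p)) (r : ℕ)
    (η : ℕ → ℝ) (θ₀ : Param p) {m : ℕ → ℕ} (s : (t : ℕ) → Fin (m t) → Fin n) : ℕ → Param p
  | 0 => θ₀
  | t + 1 =>
    proj C (iterate f C r η θ₀ s t - η t • scaling r (subHessian f (s t) (iterate f C r η θ₀ s t))
      (gradient (objective f) (iterate f C r η θ₀ s t)))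

/-- The coefficient `1 - η λ_p/λ_{r+1} + η (cK/λ_{r+1}) √(log p / m)`, where `λ_j` are the ordered
eigenvalues of `T`. With `T = H_{S_t}(θ̂^t)` it is `ξ₁^t`, with `T = ∇²f(θ_*)` it is `ξ₁^*`. -/
noncomputable def xi {p : ℕ} (c K η : ℝ) (r m : ℕ) (T : Param p →L[ℝ] Param p) : ℝ :=
  1 - η * (eigval T p / eigval T (r + 1)) +
    η * (c * K / eigval T (r + 1)) * Real.sqrt (Real.log p / m)

/-- Sampling with or without replacement. -/
inductive Sampling
  | withReplacement
  | withoutReplacement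

/-- The possible samples of size `m` from `[n]`, listed in the order of drawing. -/
def Sampling.outcomes (n m : ℕ) : Sampling → Set (Fin m → Fin n)
  | .withReplacement => Set.univ
  | .withoutReplacement => {s | Function.Injective s}

/-- Independent sub-sampling: each `S_t` is uniformly distributed over the possible samples
of size `m t`, and the samples of different iterations are independent. -/
structure IndependentSubsampling {Ω : Type*} [MeasurableSpace Ω] (μ : MeasureTheory.Measure Ω)
    (mode : Sampling) {n : ℕ} {m : ℕ → ℕ} (S : (t : ℕ) → Ω → Fin (m t) → Fin n) : Prop where
  measurable : ∀ t, Measurable (S t)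
  uniform : ∀ t, μ.map (S t) = ProbabilityTheory.uniformOn (mode.outcomes n (m t))
  indep : ProbabilityTheory.iIndepFun S μ

end NewSamp

/-! Hessians of quadratics are constant, so the sub-sampled Hessian depends on the sample but not on
the iterate. It therefore suffices to show a matrix Hoeffding bound: for p ≥ 3, outside an event of
probability at most 1/p, the quadratic form of `H_S - ∇²f` is at most `8K√(log p/m)‖v‖²`. Weyl's
inequality (`abs_eigenvalues_sub_le`) then moves each ordered eigenvalue by at most that much, and
`abs_sub_le_of_eigenvalue_bounds` compares the two coefficients.

The Hoeffding bound uses exchangeable pairs, which treat both sampling modes alike. Changing one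
random draw turns the centred sum X into X' with (X, X') exchangeable and the conditional mean of X
- X' proportional to X (`sum_sum_sub_sum_move`). So E tr X^(2q+2) is a multiple of E tr X^(2q+1)(X -
X'), which symmetrization and a scalar inequality bound by E tr X^(2q)
(`sum_tracePow_le_of_exchangeable`). Iterating and applying Markov with q ≈ log p gives the tail. -/

/-! ### Scalar power inequalities -/

theorem sub_mul_sub_pow_nonneg_of_even {l j : ℕ} (h : Even (l + j)) (x y : ℝ) :
    0 ≤ (x ^ l - y ^ l) * (x ^ j - y ^ j) := by
  rcases Nat.even_or_odd l with hl | hl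
  · have hj : Even j := (Nat.even_add.1 h).1 hl
    obtain ⟨a, rfl⟩ := even_iff_exists_two_mul.1 hl
    obtain ⟨b, rfl⟩ := even_iff_exists_two_mul.1 hj
    simp only [pow_mul]
    rcases le_total (x ^ 2) (y ^ 2) with hxy | hxy
    · exact mul_nonneg_of_nonpos_of_nonpos
        (sub_nonpos.2 (pow_le_pow_left₀ (sq_nonneg x) hxy a))
        (sub_nonpos.2 (pow_le_pow_left₀ (sq_nonneg x) hxy b))
    · exact mul_nonneg (sub_nonneg.2 (pow_le_pow_left₀ (sq_nonneg y) hxy a))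
        (sub_nonneg.2 (pow_le_pow_left₀ (sq_nonneg y) hxy b))
  · have hj : Odd j := by
      by_contra hj
      exact (Nat.not_even_iff_odd.2 hl) ((Nat.even_add.1 h).2 (Nat.not_odd_iff_even.1 hj))
    rcases le_total x y with hxy | hxy
    · exact mul_nonneg_of_nonpos_of_nonpos (sub_nonpos.2 (hl.strictMono_pow.monotone hxy))
        (sub_nonpos.2 (hj.strictMono_pow.monotone hxy))
    · exact mul_nonneg (sub_nonneg.2 (hl.strictMono_pow.monotone hxy))
        (sub_nonneg.2 (hj.strictMono_pow.monotone hxy))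

/-- Factor the difference of powers as a geometric sum and pair the term l with its reflection 2q -
l; the preceding lemma bounds each pair by the two pure powers. -/
theorem sub_mul_sub_pow_le (q : ℕ) (x y : ℝ) :
    (x - y) * (x ^ (2 * q + 1) - y ^ (2 * q + 1)) ≤
      (2 * q + 1) / 2 * ((x - y) ^ 2 * (x ^ (2 * q) + y ^ (2 * q))) := by
  have hsum : ∑ l ∈ Finset.range (2 * q + 1), x ^ l * y ^ (2 * q - l) ≤
      (2 * q + 1) / 2 * (x ^ (2 * q) + y ^ (2 * q)) := by
    have hrefl := Finset.sum_range_reflect (fun l => x ^ l * y ^ (2 * q - l)) (2 * q + 1)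
    have hterm : ∀ l ∈ Finset.range (2 * q + 1),
        x ^ l * y ^ (2 * q - l) +
          x ^ (2 * q + 1 - 1 - l) * y ^ (2 * q - (2 * q + 1 - 1 - l)) ≤
        x ^ (2 * q) + y ^ (2 * q) := by
      intro l hl
      obtain ⟨j, hj⟩ := Nat.exists_eq_add_of_le (Finset.mem_range_succ_iff.1 hl)
      have h := sub_mul_sub_pow_nonneg_of_even (l := l) (j := j) (hj ▸ even_two_mul q) x y
      rw [Nat.add_sub_cancel, hj, Nat.add_sub_cancel_left, Nat.add_sub_cancel, pow_add, pow_add]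
      linarith
    have := Finset.sum_le_sum hterm
    rw [Finset.sum_add_distrib, hrefl] at this
    simp only [Finset.sum_const, Finset.card_range, nsmul_eq_mul] at this
    push_cast at this
    linarith
  have hgeom := (Commute.all x y).mul_geom_sum₂ (2 * q + 1)
  rw [← hgeom, ← mul_assoc, ← sq]
  simp only [Nat.add_sub_cancel]
  calc _ ≤ (x - y) ^ 2 * ((2 * q + 1) / 2 * (x ^ (2 * q) + y ^ (2 * q))) :=
        mul_le_mul_of_nonneg_left hsum (sq_nonneg _)
    _ = _ := by ring

/-! ### Trace moments and exchangeable pairs -/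

namespace LinearMap.IsSymmetric

variable {E : Type*} [NormedAddCommGroup E] [InnerProductSpace ℝ E] [FiniteDimensional ℝ E]
  {p : ℕ} (hp : Module.finrank ℝ E = p) {T T' : E →ₗ[ℝ] E}

/-- The trace of the `q`-th power of a symmetric operator, as a sum over eigenvalues. -/
noncomputable def tracePow (hT : T.IsSymmetric) (q : ℕ) : ℝ :=
  ∑ a, hT.eigenvalues hp a ^ q

/-- The trace of `T ^ q * D` for a symmetric operator `T`, computed in an eigenbasis of `T`. -/
noncomputable def tracePowMul (hT : T.IsSymmetric) (q : ℕ) (D : E →ₗ[ℝ] E) : ℝ :=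
  ∑ a, hT.eigenvalues hp a ^ q *
    inner ℝ (hT.eigenvectorBasis hp a) (D (hT.eigenvectorBasis hp a))

theorem inner_eigenvectorBasis_apply (hT : T.IsSymmetric) (a : Fin p) (v : E) :
    inner ℝ (hT.eigenvectorBasis hp a) (T v) =
      hT.eigenvalues hp a * inner ℝ (hT.eigenvectorBasis hp a) v := by
  rw [← hT, hT.apply_eigenvectorBasis hp a, inner_smul_left]
  simp

theorem inner_apply_eigenvectorBasis (hT : T.IsSymmetric) (a : Fin p) (v : E) :
    inner ℝ v (T (hT.eigenvectorBasis hp a)) =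
      hT.eigenvalues hp a * inner ℝ v (hT.eigenvectorBasis hp a) := by
  rw [hT.apply_eigenvectorBasis hp a, inner_smul_right]
  simp

theorem inner_apply_self_eq_sum (hT : T.IsSymmetric) (v : E) :
    inner ℝ v (T v) =
      ∑ b, hT.eigenvalues hp b * (inner ℝ (hT.eigenvectorBasis hp b) v) ^ 2 := by
  rw [← (hT.eigenvectorBasis hp).sum_inner_mul_inner]
  refine Finset.sum_congr rfl fun b _ => ?_
  rw [hT.inner_eigenvectorBasis_apply hp, real_inner_comm v]
  ring

theorem norm_sq_eq_sum (hT : T.IsSymmetric) (v : E) :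
    ‖v‖ ^ 2 = ∑ b, (inner ℝ (hT.eigenvectorBasis hp b) v) ^ 2 := by
  rw [← (hT.eigenvectorBasis hp).sum_sq_norm_inner_right v]
  simp

/-- Expanding in both eigenbases gives nonnegative weights ⟨u_a, v_b⟩², so trace inequalities reduce
to scalar ones for pairs of eigenvalues. -/
theorem tracePowMul_sub (hT : T.IsSymmetric) (hT' : T'.IsSymmetric) (q : ℕ) :
    hT.tracePowMul hp q (T - T') = ∑ a, ∑ b, hT.eigenvalues hp a ^ q *
      (hT.eigenvalues hp a - hT'.eigenvalues hp b) *
      (inner ℝ (hT.eigenvectorBasis hp a) (hT'.eigenvectorBasis hp b)) ^ 2 := by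
  refine Finset.sum_congr rfl fun a _ => ?_
  have hone := hT'.norm_sq_eq_sum hp (hT.eigenvectorBasis hp a)
  rw [(hT.eigenvectorBasis hp).orthonormal.1 a, one_pow] at hone
  rw [LinearMap.sub_apply, inner_sub_right, hT.inner_apply_eigenvectorBasis hp,
    real_inner_self_eq_norm_sq, (hT.eigenvectorBasis hp).orthonormal.1 a, one_pow, hone,
    hT'.inner_apply_self_eq_sum hp, Finset.mul_sum, ← Finset.sum_sub_distrib, Finset.mul_sum]
  refine Finset.sum_congr rfl fun b _ => ?_
  rw [real_inner_comm]
  ring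

/-- The number (λ_a - μ_b)⟨u_a, v_b⟩ is the v_b-coordinate of (T - T')u_a, so the sum over b is a
squared norm, at most R². -/
theorem sum_sq_sub_mul_le (hT : T.IsSymmetric) (hT' : T'.IsSymmetric) (q : ℕ) {R : ℝ}
    (hR : ∀ v, ‖T v - T' v‖ ≤ R * ‖v‖) :
    ∑ a, ∑ b, hT.eigenvalues hp a ^ (2 * q) *
      (hT.eigenvalues hp a - hT'.eigenvalues hp b) ^ 2 *
      (inner ℝ (hT.eigenvectorBasis hp a) (hT'.eigenvectorBasis hp b)) ^ 2 ≤
    R ^ 2 * hT.tracePow hp (2 * q) := by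
  rw [tracePow, Finset.mul_sum]
  refine Finset.sum_le_sum fun a _ => ?_
  have hnorm := hT'.norm_sq_eq_sum hp ((T - T') (hT.eigenvectorBasis hp a))
  have hle : ‖(T - T') (hT.eigenvectorBasis hp a)‖ ^ 2 ≤ R ^ 2 := by
    refine pow_le_pow_left₀ (norm_nonneg _) ?_ 2
    simpa [(hT.eigenvectorBasis hp).orthonormal.1 a] using hR (hT.eigenvectorBasis hp a)
  calc _ = hT.eigenvalues hp a ^ (2 * q) * ‖(T - T') (hT.eigenvectorBasis hp a)‖ ^ 2 := by
        rw [hnorm, Finset.mul_sum]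
        refine Finset.sum_congr rfl fun b _ => ?_
        rw [LinearMap.sub_apply, inner_sub_right, hT.inner_apply_eigenvectorBasis hp,
          hT'.inner_eigenvectorBasis_apply hp, real_inner_comm (hT.eigenvectorBasis hp a)]
        ring
    _ ≤ hT.eigenvalues hp a ^ (2 * q) * R ^ 2 :=
        mul_le_mul_of_nonneg_left hle ((even_two_mul q).pow_nonneg _)
    _ = _ := mul_comm _ _

theorem tracePowMul_sub_add_le (hT : T.IsSymmetric) (hT' : T'.IsSymmetric) (q : ℕ) {R : ℝ}
    (hR : ∀ v, ‖T v - T' v‖ ≤ R * ‖v‖) :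
    hT.tracePowMul hp (2 * q + 1) (T - T') + hT'.tracePowMul hp (2 * q + 1) (T' - T) ≤
      (2 * q + 1) / 2 * (R ^ 2 * hT.tracePow hp (2 * q) + R ^ 2 * hT'.tracePow hp (2 * q)) := by
  have hR' : ∀ v, ‖T' v - T v‖ ≤ R * ‖v‖ := fun v => by rw [norm_sub_rev]; exact hR v
  refine le_trans ?_ (mul_le_mul_of_nonneg_left
    (add_le_add (hT.sum_sq_sub_mul_le hp hT' q hR) (hT'.sum_sq_sub_mul_le hp hT q hR'))
    (by positivity))
  rw [hT.tracePowMul_sub hp hT', hT'.tracePowMul_sub hp hT, Finset.sum_comm (γ := Fin p)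
    (f := fun b a => hT'.eigenvalues hp b ^ (2 * q + 1) * _ * _),
    Finset.sum_comm (γ := Fin p) (f := fun b a => hT'.eigenvalues hp b ^ (2 * q) * _ * _)]
  simp only [← Finset.sum_add_distrib, Finset.mul_sum]
  refine Finset.sum_le_sum fun a _ => Finset.sum_le_sum fun b _ => ?_
  rw [real_inner_comm (hT.eigenvectorBasis hp a)]
  have := mul_le_mul_of_nonneg_right
    (sub_mul_sub_pow_le q (hT.eigenvalues hp a) (hT'.eigenvalues hp b))
    (sq_nonneg (inner ℝ (hT.eigenvectorBasis hp a) (hT'.eigenvectorBasis hp b)))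
  linarith

theorem tracePowMul_sum (hT : T.IsSymmetric) (q : ℕ) {ι : Type*} (s : Finset ι)
    (D : ι → E →ₗ[ℝ] E) :
    hT.tracePowMul hp q (∑ u ∈ s, D u) = ∑ u ∈ s, hT.tracePowMul hp q (D u) := by
  simp only [tracePowMul, LinearMap.sum_apply, inner_sum, Finset.mul_sum]
  exact Finset.sum_comm

theorem tracePowMul_smul_self (hT : T.IsSymmetric) (q : ℕ) (c : ℝ) :
    hT.tracePowMul hp q (c • T) = c * hT.tracePow hp (q + 1) := by
  rw [tracePow, Finset.mul_sum]
  refine Finset.sum_congr rfl fun a _ => ?_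
  rw [LinearMap.smul_apply, inner_smul_right, hT.inner_apply_eigenvectorBasis hp,
    real_inner_self_eq_norm_sq, (hT.eigenvectorBasis hp).orthonormal.1 a]
  ring

/-- `hN` rewrites the higher moment as a sum of tr X^(2q+1)(X - X'). The involution leaves total
sums unchanged, so this is half the sum of the symmetrized expression, to which
`tracePowMul_sub_add_le` applies. -/
theorem sum_tracePow_le_of_exchangeable {Ω M : Type*} [Fintype Ω] [Fintype M]
    {Φ : Ω × M → Ω × M} (hΦ : Function.Involutive Φ) {X : Ω → E →ₗ[ℝ] E}
    (hX : ∀ ω, (X ω).IsSymmetric) {N R : ℝ}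
    (hN : ∀ ω, ∑ u, (X ω - X (Φ (ω, u)).1) = N • X ω)
    (hR : ∀ ω u v, ‖X ω v - X (Φ (ω, u)).1 v‖ ≤ R * ‖v‖) (q : ℕ) :
    N * ∑ ω, (hX ω).tracePow hp (2 * q + 2) ≤
      (2 * q + 1) / 2 * (Fintype.card M * R ^ 2) * ∑ ω, (hX ω).tracePow hp (2 * q) := by
  let G : Ω × M → ℝ := fun z =>
    (hX z.1).tracePowMul hp (2 * q + 1) (X z.1 - X (Φ z).1)
  let H : Ω × M → ℝ := fun z => (hX z.1).tracePow hp (2 * q)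
  have hG : ∑ z, G z = N * ∑ ω, (hX ω).tracePow hp (2 * q + 2) := by
    rw [Fintype.sum_prod_type, Finset.mul_sum]
    refine Finset.sum_congr rfl fun ω _ => ?_
    rw [← (hX ω).tracePowMul_smul_self hp, ← hN, (hX ω).tracePowMul_sum hp]
  have hGΦ : ∑ z, G (Φ z) = ∑ z, G z := hΦ.bijective.sum_comp G
  have hHΦ : ∑ z, H (Φ z) = ∑ z, H z := hΦ.bijective.sum_comp H
  have hH : ∑ z, H z = Fintype.card M * ∑ ω, (hX ω).tracePow hp (2 * q) := by
    rw [Fintype.sum_prod_type, Finset.mul_sum]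
    refine Finset.sum_congr rfl fun ω _ => ?_
    change ∑ _u : M, (hX ω).tracePow hp (2 * q) = _
    simp
  have hle : ∑ z, (G z + G (Φ z)) ≤
      ∑ z, (2 * q + 1) / 2 * (R ^ 2 * H z + R ^ 2 * H (Φ z)) := by
    refine Finset.sum_le_sum fun z _ => ?_
    have := (hX z.1).tracePowMul_sub_add_le hp (hX (Φ z).1) q (hR z.1 z.2)
    simpa only [G, H, hΦ z] using this
  rw [← Finset.mul_sum, Finset.sum_add_distrib, Finset.sum_add_distrib, ← Finset.mul_sum,
    ← Finset.mul_sum, hGΦ, hHΦ, hG, hH] at hle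
  linarith

/-! ### Weyl's inequality and spectral tails -/

theorem inner_eigenvectorBasis_eq_zero_of_mem_span (hT : T.IsSymmetric) {P : Fin p → Prop} {w : E}
    (hw : w ∈ Submodule.span ℝ (Set.range fun a : {a // P a} => hT.eigenvectorBasis hp a))
    {b : Fin p} (hb : ¬ P b) : inner ℝ (hT.eigenvectorBasis hp b) w = 0 := by
  induction hw using Submodule.span_induction with
  | mem x hx =>
    obtain ⟨a, rfl⟩ := hx
    exact (hT.eigenvectorBasis hp).orthonormal.2 fun h => hb (h ▸ a.2)
  | zero => exact inner_zero_right _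
  | add x y _ _ hx hy => rw [inner_add_right, hx, hy, add_zero]
  | smul c x _ hx => rw [inner_smul_right, hx, mul_zero]

theorem finrank_span_eigenvectorBasis (hT : T.IsSymmetric) (P : Fin p → Prop) [DecidablePred P] :
    Module.finrank ℝ
      (Submodule.span ℝ (Set.range fun a : {a // P a} => hT.eigenvectorBasis hp a)) =
      Fintype.card {a // P a} :=
  finrank_span_eq_card
    ((hT.eigenvectorBasis hp).orthonormal.linearIndependent.comp _ Subtype.val_injective)

/-- With zero-based j, the leading j + 1 eigenvectors of T and the trailing p - j of T' span spaces
whose dimensions add up to p + 1. They share a nonzero w, whose two Rayleigh quotients give the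
comparison. -/
theorem eigenvalues_le_add_of_inner_le (hT : T.IsSymmetric) (hT' : T'.IsSymmetric) {δ : ℝ}
    (h : ∀ v, inner ℝ v (T v) ≤ inner ℝ v (T' v) + δ * ‖v‖ ^ 2) (j : Fin p) :
    hT.eigenvalues hp j ≤ hT'.eigenvalues hp j + δ := by
  let U := Submodule.span ℝ (Set.range fun a : {a : Fin p // a ≤ j} => hT.eigenvectorBasis hp a)
  let V := Submodule.span ℝ (Set.range fun a : {a : Fin p // j ≤ a} => hT'.eigenvectorBasis hp a)
  have hUV : ¬ Disjoint U V := fun hd => by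
    have := Submodule.finrank_add_finrank_le_of_disjoint hd
    have hU : Module.finrank ℝ U = j + 1 := by
      rw [hT.finrank_span_eigenvectorBasis hp, Fintype.card_subtype,
        Finset.filter_ge_eq_Iic,
        Fin.card_Iic]
    have hV : Module.finrank ℝ V = p - j := by
      rw [hT'.finrank_span_eigenvectorBasis hp, Fintype.card_subtype, Finset.filter_le_eq_Ici,
        Fin.card_Ici]
    omega
  obtain ⟨w, hwU, hwV, hw0⟩ : ∃ w ∈ U, w ∈ V ∧ w ≠ 0 := by
    simpa [Submodule.disjoint_def] using hUV
  have hlower : hT.eigenvalues hp j * ‖w‖ ^ 2 ≤ inner ℝ w (T w) := by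
    rw [hT.inner_apply_self_eq_sum hp, hT.norm_sq_eq_sum hp, Finset.mul_sum]
    refine Finset.sum_le_sum fun a _ => ?_
    by_cases ha : a ≤ j
    · exact mul_le_mul_of_nonneg_right (hT.eigenvalues_antitone hp ha) (sq_nonneg _)
    · simp [hT.inner_eigenvectorBasis_eq_zero_of_mem_span hp hwU ha]
  have hupper : inner ℝ w (T' w) ≤ hT'.eigenvalues hp j * ‖w‖ ^ 2 := by
    rw [hT'.inner_apply_self_eq_sum hp, hT'.norm_sq_eq_sum hp, Finset.mul_sum]
    refine Finset.sum_le_sum fun a _ => ?_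
    by_cases ha : j ≤ a
    · exact mul_le_mul_of_nonneg_right (hT'.eigenvalues_antitone hp ha) (sq_nonneg _)
    · simp [hT'.inner_eigenvectorBasis_eq_zero_of_mem_span hp hwV ha]
  have hpos : 0 < ‖w‖ ^ 2 := by positivity
  refine le_of_mul_le_mul_right ?_ hpos
  linarith [h w]

/-- **Weyl's perturbation inequality**: eigenvalues in decreasing order move by at most the size of
the perturbation, measured by its quadratic form. -/
theorem abs_eigenvalues_sub_le (hT : T.IsSymmetric) (hT' : T'.IsSymmetric) {δ : ℝ}
    (h : ∀ v, |inner ℝ v ((T - T') v)| ≤ δ * ‖v‖ ^ 2) (j : Fin p) :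
    |hT.eigenvalues hp j - hT'.eigenvalues hp j| ≤ δ := by
  simp only [LinearMap.sub_apply, inner_sub_right, abs_le] at h
  have h₁ := hT.eigenvalues_le_add_of_inner_le hp hT' (δ := δ) (fun v => by linarith [(h v).2]) j
  have h₂ := hT'.eigenvalues_le_add_of_inner_le hp hT (δ := δ) (fun v => by linarith [(h v).1]) j
  exact abs_le.2 ⟨by linarith, by linarith⟩

theorem pow_le_tracePow_of_lt_inner (hT : T.IsSymmetric) {τ : ℝ} (hτ : 0 ≤ τ) {v : E}
    (hv : τ * ‖v‖ ^ 2 < |inner ℝ v (T v)|) (q : ℕ) :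
    τ ^ (2 * q) ≤ hT.tracePow hp (2 * q) := by
  obtain ⟨a, ha⟩ : ∃ a, τ ≤ |hT.eigenvalues hp a| := by
    by_contra! hlt
    refine hv.not_ge ?_
    rw [hT.inner_apply_self_eq_sum hp, hT.norm_sq_eq_sum hp, Finset.mul_sum]
    refine (Finset.abs_sum_le_sum_abs _ _).trans (Finset.sum_le_sum fun a _ => ?_)
    rw [abs_mul, abs_of_nonneg (sq_nonneg (inner ℝ (hT.eigenvectorBasis hp a) v))]
    exact mul_le_mul_of_nonneg_right (hlt a).le (sq_nonneg _)
  calc τ ^ (2 * q) ≤ |hT.eigenvalues hp a| ^ (2 * q) := pow_le_pow_left₀ hτ ha _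
    _ = hT.eigenvalues hp a ^ (2 * q) := (even_two_mul q).pow_abs _
    _ ≤ hT.tracePow hp (2 * q) :=
      Finset.single_le_sum (f := fun a => hT.eigenvalues hp a ^ (2 * q))
        (fun a _ => (even_two_mul q).pow_nonneg _) (Finset.mem_univ a)

end LinearMap.IsSymmetric

/-! ### Exchanging draws in a random sample -/

namespace NewSamp.Sampling

variable {n m : ℕ}

/-- Replace the `j`-th draw by `i`; when sampling without replacement, if `i` was already drawn then
the two draws are exchanged. -/
def move : Sampling → (Fin m → Fin n) → Fin m → Fin n → Fin m → Fin n
  | .withReplacement, s, j, i => Function.update s j i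
  | .withoutReplacement, s, j, i => Equiv.swap (s j) i ∘ s

theorem move_mem_outcomes {mode : Sampling} {s : Fin m → Fin n} (hs : s ∈ mode.outcomes n m)
    (j : Fin m) (i : Fin n) : mode.move s j i ∈ mode.outcomes n m := by
  cases mode with
  | withReplacement => exact Set.mem_univ _
  | withoutReplacement => exact (Equiv.swap (s j) i).injective.comp hs

theorem move_apply_self (mode : Sampling) (s : Fin m → Fin n) (j : Fin m) (i : Fin n) :
    mode.move s j i j = i := by
  cases mode <;> simp [move]

theorem move_move (mode : Sampling) (s : Fin m → Fin n) (j : Fin m) (i : Fin n) :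
    mode.move (mode.move s j i) j (s j) = s := by
  cases mode with
  | withReplacement => simp [move]
  | withoutReplacement =>
    funext l
    simp [move, Equiv.swap_comm i]

/-- The involution on pairs of a sample and a move that exchanges a sample with the moved one. -/
def exchange (mode : Sampling) (z : mode.outcomes n m × (Fin m × Fin n)) :
    mode.outcomes n m × (Fin m × Fin n) :=
  (⟨mode.move z.1.1 z.2.1 z.2.2, move_mem_outcomes z.1.2 _ _⟩, (z.2.1, z.1.1 z.2.1))

theorem exchange_involutive (mode : Sampling) :
    Function.Involutive (mode.exchange (n := n) (m := m)) := by
  rintro ⟨⟨s, hs⟩, j, i⟩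
  simp [exchange, move_apply_self, move_move]

variable {V : Type*} [AddCommGroup V]

theorem sum_sub_sum_update (B : Fin n → V) (s : Fin m → Fin n) (j : Fin m) (i : Fin n) :
    ∑ l, B (s l) - ∑ l, B (Function.update s j i l) = B (s j) - B i := by
  rw [← Finset.sum_sub_distrib, Finset.sum_eq_single j]
  · simp
  · intro l _ hl
    simp [hl]
  · simp

theorem sum_swap_of_mem_range (B : Fin n → V) {s : Fin m → Fin n} (hs : s.Injective)
    (j : Fin m) {i : Fin n} (hi : i ∈ Set.range s) :
    ∑ l, B (withoutReplacement.move s j i l) = ∑ l, B (s l) := by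
  obtain ⟨k, rfl⟩ := hi
  simp only [move, Function.comp_apply, ← hs.map_swap]
  exact Fintype.sum_equiv (Equiv.swap j k) _ _ fun _ => rfl

theorem move_eq_update_of_notMem_range {s : Fin m → Fin n} (hs : s.Injective) (j : Fin m)
    {i : Fin n} (hi : i ∉ Set.range s) :
    withoutReplacement.move s j i = Function.update s j i := by
  funext l
  rcases eq_or_ne l j with rfl | hl
  · simp [move]
  · rw [Function.update_of_ne hl]
    exact Equiv.swap_apply_of_ne_of_ne (hs.ne hl) fun h => hi ⟨l, h⟩

theorem sum_sub_sum_move (B : Fin n → V) {mode : Sampling} {s : Fin m → Fin n}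
    (hs : s ∈ mode.outcomes n m) (j : Fin m) (i : Fin n) :
    ∑ l, B (s l) - ∑ l, B (mode.move s j i l) = B (s j) - B i ∨
      ∑ l, B (s l) - ∑ l, B (mode.move s j i l) = 0 := by
  cases mode with
  | withReplacement => exact Or.inl (sum_sub_sum_update B s j i)
  | withoutReplacement =>
    by_cases hi : i ∈ Set.range s
    · exact Or.inr (by rw [sum_swap_of_mem_range B hs j hi, sub_self])
    · rw [move_eq_update_of_notMem_range hs j hi]
      exact Or.inl (sum_sub_sum_update B s j i)

/-- This is the linear regression property of the exchangeable pair, with the same factor n in both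
modes. -/
theorem sum_sum_sub_sum_move {B : Fin n → V} (hB : ∑ i, B i = 0) {mode : Sampling}
    {s : Fin m → Fin n} (hs : s ∈ mode.outcomes n m) :
    ∑ u : Fin m × Fin n, (∑ l, B (s l) - ∑ l, B (mode.move s u.1 u.2 l)) =
      n • ∑ l, B (s l) := by
  classical
  rw [Fintype.sum_prod_type]
  cases mode with
  | withReplacement =>
    simp only [move, sum_sub_sum_update, Finset.sum_sub_distrib, hB]
    simp [Finset.smul_sum]
  | withoutReplacement =>
    have hterm : ∀ j i, ∑ l, B (s l) - ∑ l, B (withoutReplacement.move s j i l) =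
        (B (s j) - B i) - if i ∈ Finset.univ.image s then B (s j) - B i else 0 := by
      intro j i
      split_ifs with hi
      · rw [sum_swap_of_mem_range B hs j (by simpa using hi), sub_self, sub_self]
      · rw [move_eq_update_of_notMem_range hs j (by simpa using hi), sum_sub_sum_update, sub_zero]
    -- The bracket corrects for values i already drawn, whose moves change nothing; summed over j it
    -- cancels.
    have hinner : ∀ j, ∑ i, (∑ l, B (s l) - ∑ l, B (withoutReplacement.move s j i l)) =
        n • B (s j) - (m • B (s j) - ∑ l, B (s l)) := by
      intro j
      simp only [hterm, Finset.sum_sub_distrib, hB, ← Finset.sum_filter,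
        Finset.filter_mem_eq_inter, Finset.univ_inter, Finset.sum_image hs.injOn]
      simp
    simp only [hinner, Finset.sum_sub_distrib, Finset.smul_sum]
    simp [← Finset.smul_sum]

end NewSamp.Sampling

/-! ### Matrix Hoeffding inequality -/

namespace NewSamp

open LinearMap.IsSymmetric

variable {E : Type*} [NormedAddCommGroup E] [InnerProductSpace ℝ E]
  {p n m : ℕ} {A : Fin n → E →ₗ[ℝ] E}

/-- An operator of the list `A`, minus the average of the list. -/
noncomputable def centered (A : Fin n → E →ₗ[ℝ] E) (i : Fin n) : E →ₗ[ℝ] E :=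
  A i - (n : ℝ)⁻¹ • ∑ l, A l

theorem sum_centered (A : Fin n → E →ₗ[ℝ] E) : ∑ i, centered A i = 0 := by
  rcases Nat.eq_zero_or_pos n with rfl | hn
  · simp
  · have : (n : ℝ) ≠ 0 := by positivity
    simp only [centered, Finset.sum_sub_distrib, Finset.sum_const, Finset.card_univ,
      Fintype.card_fin, ← Nat.cast_smul_eq_nsmul ℝ, smul_smul, mul_inv_cancel₀ this, one_smul,
      sub_self]

theorem isSymmetric_sum {ι : Type*} (s : Finset ι) {T : ι → E →ₗ[ℝ] E}
    (hT : ∀ i, (T i).IsSymmetric) : (∑ i ∈ s, T i).IsSymmetric := fun v w => by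
  simp only [LinearMap.sum_apply, sum_inner, inner_sum, hT _ v w]

theorem isSymmetric_real_smul {T : E →ₗ[ℝ] E} (hT : T.IsSymmetric) (a : ℝ) :
    (a • T).IsSymmetric := fun v w => by
  simp only [LinearMap.smul_apply, real_inner_smul_left, real_inner_smul_right, hT v w]

theorem isSymmetric_sum_centered (hA : ∀ i, (A i).IsSymmetric) (s : Fin m → Fin n) :
    (∑ l, centered A (s l)).IsSymmetric :=
  isSymmetric_sum _ fun l => (hA (s l)).sub (isSymmetric_real_smul (isSymmetric_sum _ hA) _)

variable [FiniteDimensional ℝ E]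

/-- The exchangeable-pair bound is used with R = 2K, mn moves and N = n; the factor n cancels. -/
theorem sum_tracePow_sum_centered_succ_le (hp : Module.finrank ℝ E = p) (hn : 0 < n)
    (hA : ∀ i, (A i).IsSymmetric) {K : ℝ}
    (hK : ∀ i v, ‖A i v‖ ≤ K * ‖v‖) (mode : Sampling) [Fintype (mode.outcomes n m)] (q : ℕ) :
    ∑ s : mode.outcomes n m, (isSymmetric_sum_centered hA s.1).tracePow hp (2 * q + 2) ≤
      (2 * q + 1) * (2 * m * K ^ 2) *
        ∑ s : mode.outcomes n m, (isSymmetric_sum_centered hA s.1).tracePow hp (2 * q) := by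
  have hn' : (0 : ℝ) < n := by positivity
  have hR : ∀ (s : mode.outcomes n m) (u : Fin m × Fin n) (v : E),
      ‖(∑ l, centered A (s.1 l)) v - (∑ l, centered A ((mode.exchange (s, u)).1.1 l)) v‖ ≤
        (2 * K) * ‖v‖ := by
    intro s u v
    rw [← LinearMap.sub_apply]
    rcases Sampling.sum_sub_sum_move (centered A) s.2 u.1 u.2 with h | h
    · simp only [Sampling.exchange]
      rw [h, centered, centered, sub_sub_sub_cancel_right, LinearMap.sub_apply]
      refine (norm_sub_le _ _).trans ?_
      linarith [hK (s.1 u.1) v, hK u.2 v]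
    · simp only [Sampling.exchange]
      rw [h, LinearMap.zero_apply, norm_zero]
      linarith [hK u.2 v, norm_nonneg (A u.2 v)]
  have hN : ∀ s : mode.outcomes n m, ∑ u,
      (∑ l, centered A (s.1 l) - ∑ l, centered A ((mode.exchange (s, u)).1.1 l)) =
        (n : ℝ) • ∑ l, centered A (s.1 l) := fun s => by
    rw [Nat.cast_smul_eq_nsmul]
    exact Sampling.sum_sum_sub_sum_move (sum_centered A) s.2
  have h := sum_tracePow_le_of_exchangeable hp mode.exchange_involutive
    (X := fun s : mode.outcomes n m => ∑ l, centered A (s.1 l))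
    (fun s => isSymmetric_sum_centered hA s.1) hN hR q
  refine le_of_mul_le_mul_left (h.trans (le_of_eq ?_)) hn'
  rw [Fintype.card_prod, Fintype.card_fin, Fintype.card_fin]
  push_cast
  ring

theorem sum_tracePow_sum_centered_le (hp : Module.finrank ℝ E = p) (hn : 0 < n)
    (hA : ∀ i, (A i).IsSymmetric) {K : ℝ}
    (hK : ∀ i v, ‖A i v‖ ≤ K * ‖v‖) (mode : Sampling) [Fintype (mode.outcomes n m)] (q : ℕ) :
    ∑ s : mode.outcomes n m, (isSymmetric_sum_centered hA s.1).tracePow hp (2 * q) ≤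
      (4 * q * m * K ^ 2) ^ q * (p * Fintype.card (mode.outcomes n m)) := by
  -- Keeping q fixed in the base lets every factor 2i + 1 be replaced by 2q.
  suffices h : ∀ i ≤ q,
      ∑ s : mode.outcomes n m, (isSymmetric_sum_centered hA s.1).tracePow hp (2 * i) ≤
        (4 * q * m * K ^ 2) ^ i * (p * Fintype.card (mode.outcomes n m)) from h q le_rfl
  intro i
  induction i with
  | zero =>
    intro _
    simp [tracePow, mul_comm]
  | succ i ih =>
    intro hi
    have hiq : ((i : ℝ) + 1) ≤ q := by exact_mod_cast hi
    calc _ ≤ _ := sum_tracePow_sum_centered_succ_le hp hn hA hK mode i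
      _ ≤ (2 * i + 1) * (2 * m * K ^ 2) *
          ((4 * q * m * K ^ 2) ^ i * (p * Fintype.card (mode.outcomes n m))) :=
        mul_le_mul_of_nonneg_left (ih (by omega)) (by positivity)
      _ ≤ (4 * q * m * K ^ 2) *
          ((4 * q * m * K ^ 2) ^ i * (p * Fintype.card (mode.outcomes n m))) := by
        refine mul_le_mul_of_nonneg_right ?_ (by positivity)
        have : 0 ≤ (m : ℝ) * K ^ 2 := by positivity
        nlinarith
      _ = _ := by ring

open Classical in
/-- Matrix Hoeffding inequality for a random sample of symmetric operators, in counting form. -/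
theorem card_mul_le_card_outcomes (hp : Module.finrank ℝ E = p) (hn : 0 < n) (hm : 0 < m)
    (hp3 : 3 ≤ p) (hA : ∀ i, (A i).IsSymmetric) {K : ℝ} (hK0 : 0 < K)
    (hK : ∀ i v, ‖A i v‖ ≤ K * ‖v‖) (mode : Sampling) :
    p * Fintype.card {s : mode.outcomes n m // ∃ v,
        8 * K * Real.sqrt (m * Real.log p) * ‖v‖ ^ 2 <
          |inner ℝ v ((∑ l, centered A (s.1 l)) v)|} ≤
      Fintype.card (mode.outcomes n m) := by
  set τ : ℝ := 8 * K * Real.sqrt (m * Real.log p) with hτ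
  set q : ℕ := ⌈Real.log p⌉₊ with hq
  have hp0 : (0 : ℝ) < p := by positivity
  have hm0 : (0 : ℝ) < m := by positivity
  have hlog : 1 ≤ Real.log p := by
    rw [Real.le_log_iff_exp_le hp0]
    have : (3 : ℝ) ≤ p := by exact_mod_cast hp3
    linarith [Real.exp_one_lt_d9]
  have hq1 : Real.log p ≤ q := Nat.le_ceil _
  have hq2 : (q : ℝ) ≤ 2 * Real.log p := by
    linarith [Nat.ceil_lt_add_one (zero_le_one.trans hlog)]
  let bad : Finset (mode.outcomes n m) := Finset.univ.filter fun s => ∃ v,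
    τ * ‖v‖ ^ 2 < |inner ℝ v ((∑ l, centered A (s.1 l)) v)|
  have hmarkov : bad.card * τ ^ (2 * q) ≤
      (4 * q * m * K ^ 2) ^ q * (p * Fintype.card (mode.outcomes n m)) := by
    refine le_trans ?_ (sum_tracePow_sum_centered_le hp hn hA hK mode q)
    rw [← nsmul_eq_mul, ← Finset.sum_const]
    refine (Finset.sum_le_sum fun s hs => ?_).trans
      (Finset.sum_le_sum_of_subset_of_nonneg (Finset.subset_univ bad) fun s _ _ =>
        Finset.sum_nonneg fun a _ => (even_two_mul q).pow_nonneg _)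
    obtain ⟨v, hv⟩ := (Finset.mem_filter.1 hs).2
    exact pow_le_tracePow_of_lt_inner hp _ (by positivity) hv q
  -- Since q ≤ 2 log p, c dominates the moment base 4qmK², while τ² = 8c. The remaining 8^q ≥ e^(2q)
  -- ≥ p² pays for the dimension factor p and for the probability 1/p.
  set c : ℝ := 8 * m * K ^ 2 * Real.log p with hc
  have hc0 : 0 < c := by positivity
  have hτc : τ ^ (2 * q) = 8 ^ q * c ^ q := by
    rw [pow_mul, ← mul_pow, hτ, mul_pow, Real.sq_sqrt (by positivity), hc]
    ring
  have hexp : (p : ℝ) ^ 2 ≤ 8 ^ q := by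
    have h8 : Real.exp 2 ≤ 8 := by
      rw [show (2 : ℝ) = 1 + 1 by norm_num, Real.exp_add]
      nlinarith [Real.exp_one_lt_d9, Real.exp_pos 1]
    calc (p : ℝ) ^ 2 = Real.exp (Real.log p * 2) := by
          rw [Real.exp_mul, Real.exp_log hp0]; norm_num
      _ ≤ Real.exp (q * 2) := Real.exp_le_exp.2 (by linarith)
      _ = Real.exp 2 ^ q := Real.exp_nat_mul 2 q
      _ ≤ 8 ^ q := pow_le_pow_left₀ (Real.exp_pos 2).le h8 q
  have hbound : bad.card * (p : ℝ) ^ 2 ≤ p * Fintype.card (mode.outcomes n m) := by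
    refine le_of_mul_le_mul_right ?_ (pow_pos hc0 q)
    calc bad.card * (p : ℝ) ^ 2 * c ^ q ≤ bad.card * 8 ^ q * c ^ q := by gcongr
      _ = bad.card * τ ^ (2 * q) := by rw [hτc, mul_assoc]
      _ ≤ _ := hmarkov
      _ ≤ c ^ q * (p * Fintype.card (mode.outcomes n m)) := by
        gcongr
        rw [hc]
        have : 0 ≤ (m : ℝ) * K ^ 2 := by positivity
        nlinarith
      _ = _ := mul_comm _ _
  rw [Fintype.card_subtype]
  have : (p : ℝ) * bad.card ≤ Fintype.card (mode.outcomes n m) := by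
    refine le_of_mul_le_mul_left ?_ hp0
    linarith
  exact_mod_cast this

theorem real_uniformOn_le (hp : Module.finrank ℝ E = p) (hn : 0 < n) (hm : 0 < m)
    (hp3 : 3 ≤ p) (hA : ∀ i, (A i).IsSymmetric) {K : ℝ} (hK0 : 0 < K)
    (hK : ∀ i v, ‖A i v‖ ≤ K * ‖v‖) (mode : Sampling) :
    (ProbabilityTheory.uniformOn (mode.outcomes n m)).real {s | ∃ v,
        8 * K * Real.sqrt (m * Real.log p) * ‖v‖ ^ 2 <
          |inner ℝ v ((∑ l, centered A (s l)) v)|} ≤ 1 / p := by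
  classical
  have hcard := card_mul_le_card_outcomes hp hn hm hp3 hA hK0 hK mode
  set bad : Set (Fin m → Fin n) := {s | ∃ v, 8 * K * Real.sqrt (m * Real.log p) * ‖v‖ ^ 2 <
    |inner ℝ v ((∑ l, centered A (s l)) v)|}
  have hp0 : (0 : ℝ) < p := by positivity
  have hinter : ((mode.outcomes n m).toFinset ∩ bad.toFinset).card =
      Fintype.card {s : mode.outcomes n m // s.1 ∈ bad} := by
    rw [← Set.toFinset_inter, Set.toFinset_card]
    exact Fintype.card_congr (Equiv.subtypeSubtypeEquivSubtypeInter _ _).symm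
  have h := ProbabilityTheory.uniformOn_apply_finset (s := (mode.outcomes n m).toFinset)
    (t := bad.toFinset)
  rw [Set.coe_toFinset, Set.coe_toFinset] at h
  rw [MeasureTheory.measureReal_def, h, hinter, ENNReal.toReal_div, ENNReal.toReal_natCast,
    ENNReal.toReal_natCast, Set.toFinset_card]
  have hcard' : (p : ℝ) * Fintype.card {s : mode.outcomes n m // s.1 ∈ bad} ≤
      Fintype.card (mode.outcomes n m) := by exact_mod_cast hcard
  -- The denominator may be zero: no sample without replacement exists when m > n.
  refine div_le_of_le_mul₀ (by positivity) (by positivity) ?_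
  rw [one_div, inv_mul_eq_div, le_div_iff₀ hp0]
  linarith

end NewSamp

/-! ### Quadratic Hessians and comparison of the coefficients -/

namespace NewSamp

variable {p n m : ℕ}

theorem hessian_eq {g : Param p → ℝ} {A : Param p →L[ℝ] Param p} (hA : IsSelfAdjoint A)
    {b : Param p} {d : ℝ} (hg : ∀ θ, g θ = (1 / 2) * inner ℝ (A θ) θ + inner ℝ b θ + d)
    (θ : Param p) : hessian g θ = A := by
  have hgrad : gradient g = fun θ => A θ + b := by
    refine gradient_eq fun θ => ?_
    rw [hasGradientAt_iff_hasFDerivAt, funext hg]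
    have h := ((((A.hasFDerivAt (x := θ)).inner ℝ (hasFDerivAt_id θ)).const_mul (1 / 2)).add
      ((hasFDerivAt_const b θ).inner ℝ (hasFDerivAt_id θ))).add_const d
    refine h.congr_fderiv ?_
    ext v
    have hsymm : inner ℝ (A v) θ = inner ℝ (A θ) v := by
      rw [hA.isSymmetric.apply_clm, real_inner_comm]
    simp [hsymm]
    ring
  rw [hessian, hgrad]
  exact (A.hasFDerivAt.add_const b).fderiv

theorem IsQuadratic.isSelfAdjoint_hessian {g : Param p → ℝ} (hg : IsQuadratic g) (θ : Param p) :
    IsSelfAdjoint (hessian g θ) := by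
  obtain ⟨A, b, d, hA, h⟩ := hg
  rwa [hessian_eq hA h]

theorem IsQuadratic.hessian_eq_hessian {g : Param p → ℝ} (hg : IsQuadratic g) (θ θ' : Param p) :
    hessian g θ = hessian g θ' := by
  obtain ⟨A, b, d, hA, h⟩ := hg
  rw [hessian_eq hA h, hessian_eq hA h]

theorem hessian_objective {f : Fin n → Param p → ℝ} (hf : ∀ i, IsQuadratic (f i)) (θ : Param p) :
    hessian (objective f) θ = (n : ℝ)⁻¹ • ∑ i, hessian (f i) θ := by
  choose A b d hA h using hf
  simp only [fun i => hessian_eq (hA i) (h i)]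
  refine hessian_eq (b := (n : ℝ)⁻¹ • ∑ i, b i) (d := (n : ℝ)⁻¹ * ∑ i, d i) ?_ (fun θ => ?_) θ
  · rw [ContinuousLinearMap.isSelfAdjoint_iff_isSymmetric]
    simpa using isSymmetric_real_smul
      (isSymmetric_sum Finset.univ fun i => (hA i).isSymmetric) (n : ℝ)⁻¹
  · simp only [objective, h, Finset.sum_add_distrib, smul_apply,
      sum_apply, real_inner_smul_left, sum_inner, ← Finset.mul_sum]
    ring

theorem eigval_eq {T : Param p →L[ℝ] Param p} (hT : (T : Param p →ₗ[ℝ] Param p).IsSymmetric)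
    {j : ℕ} (h₁ : 1 ≤ j) (h₂ : j ≤ p) :
    eigval T j = hT.eigenvalues finrank_euclideanSpace_fin ⟨j - 1, by omega⟩ := by
  rw [eigval, dif_pos ⟨hT, h₁, h₂⟩]

theorem abs_eigval_sub_le {T T' : Param p →L[ℝ] Param p}
    (hT : (T : Param p →ₗ[ℝ] Param p).IsSymmetric) (hT' : (T' : Param p →ₗ[ℝ] Param p).IsSymmetric)
    {δ : ℝ} (h : ∀ v, |inner ℝ v ((T - T') v)| ≤ δ * ‖v‖ ^ 2) {j : ℕ} (h₁ : 1 ≤ j) (h₂ : j ≤ p) :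
    |eigval T j - eigval T' j| ≤ δ := by
  rw [eigval_eq hT h₁ h₂, eigval_eq hT' h₁ h₂]
  exact hT.abs_eigenvalues_sub_le _ hT' h _

theorem exists_eigval_eq_inner {T : Param p →L[ℝ] Param p}
    (hT : (T : Param p →ₗ[ℝ] Param p).IsSymmetric) {j : ℕ} (h₁ : 1 ≤ j) (h₂ : j ≤ p) :
    ∃ v, ‖v‖ = 1 ∧ eigval T j = inner ℝ (T v) v := by
  refine ⟨hT.eigenvectorBasis finrank_euclideanSpace_fin ⟨j - 1, by omega⟩,
    (hT.eigenvectorBasis finrank_euclideanSpace_fin).orthonormal.1 _, ?_⟩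
  have h := hT.inner_apply_eigenvectorBasis finrank_euclideanSpace_fin ⟨j - 1, by omega⟩
    (hT.eigenvectorBasis finrank_euclideanSpace_fin ⟨j - 1, by omega⟩)
  rw [real_inner_self_eq_norm_sq, (hT.eigenvectorBasis _).orthonormal.1, one_pow, mul_one] at h
  rw [real_inner_comm, eigval_eq hT h₁ h₂]
  exact h.symm

theorem abs_sub_le_of_eigenvalue_bounds {x y x' y' c K k ε : ℝ} (hc : 0 < c) (hK : 0 < K)
    (hk : 0 < k) (hε : 0 ≤ ε) (hx' : |x'| ≤ K) (hky' : k ≤ y') (hy'K : y' ≤ K)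
    (hx : |x - x'| ≤ 8 * K * ε) (hy : |y - y'| ≤ 8 * K * ε) (hlt : 8 * K * ε < k) :
    |(1 - 1 * (x / y) + 1 * (c * K / y) * ε) - (1 - 1 * (x' / y') + 1 * (c * K / y') * ε)| ≤
      (16 + c) * K ^ 2 * ε / (k * (k - 8 * K * ε)) := by
  have hy'0 : 0 < y' := hk.trans_le hky'
  have hgap : 0 < k - 8 * K * ε := sub_pos.2 hlt
  have hyge : k - 8 * K * ε ≤ y := by linarith [(abs_le.1 hy).1]
  have hy0 : 0 < y := hgap.trans_le hyge
  -- From 8Kε < k ≤ y' ≤ K; this makes the term quadratic in ε linear.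
  have hε1 : 8 * ε ≤ 1 := by
    refine le_of_mul_le_mul_left (a := K) ?_ hK
    linarith
  have heq : (1 - 1 * (x / y) + 1 * (c * K / y) * ε) - (1 - 1 * (x' / y') + 1 * (c * K / y') * ε) =
      (x' * (y - y') - (x - x') * y' - c * K * ε * (y - y')) / (y' * y) := by
    field_simp
    ring
  rw [heq, abs_div, abs_of_pos (mul_pos hy'0 hy0)]
  refine div_le_div₀ (by positivity) ?_ (mul_pos hk hgap)
    (mul_le_mul hky' hyge hgap.le hy'0.le)
  have h₁ : |x' * (y - y')| ≤ K * (8 * K * ε) := by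
    rw [abs_mul]
    exact mul_le_mul hx' hy (abs_nonneg _) hK.le
  have h₂ : |(x - x') * y'| ≤ 8 * K * ε * K := by
    rw [abs_mul, abs_of_pos hy'0]
    exact mul_le_mul hx hy'K hy'0.le (by positivity)
  have h₃ : |c * K * ε * (y - y')| ≤ c * K * ε * (8 * K * ε) := by
    rw [abs_mul, abs_of_nonneg (by positivity : 0 ≤ c * K * ε)]
    exact mul_le_mul_of_nonneg_left hy (by positivity)
  have h₄ : c * K * ε * (8 * K * ε) ≤ c * K ^ 2 * ε := by
    calc c * K * ε * (8 * K * ε) = c * K ^ 2 * ε * (8 * ε) := by ring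
      _ ≤ c * K ^ 2 * ε := mul_le_of_le_one_right (by positivity) hε1
  have h₅ := abs_sub (x' * (y - y')) ((x - x') * y')
  have h₆ := abs_sub (x' * (y - y') - (x - x') * y') (c * K * ε * (y - y'))
  nlinarith

/-- Rayleigh quotients place the eigenvalues of H in [k, K], and Weyl's inequality controls those of
T at the indices p and r + 1. -/
theorem abs_xi_sub_xi_le {T H : Param p →L[ℝ] Param p} {r : ℕ} (hr : r < p)
    (hT : (T : Param p →ₗ[ℝ] Param p).IsSymmetric) (hH : (H : Param p →ₗ[ℝ] Param p).IsSymmetric)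
    {c K k : ℝ} (hc : 0 < c) (hk : 0 < k) (hHK : ∀ v, ‖H v‖ ≤ K * ‖v‖)
    (hHk : ∀ v, k * ‖v‖ ^ 2 ≤ inner ℝ (H v) v)
    (hlt : 8 * K * Real.sqrt (Real.log p / m) < k)
    (h : ∀ v, |inner ℝ v ((T - H) v)| ≤ 8 * K * Real.sqrt (Real.log p / m) * ‖v‖ ^ 2) :
    |xi c K 1 r m T - xi c K 1 r m H| ≤
      (16 + c) * K ^ 2 * Real.sqrt (Real.log p / m) /
        (k * (k - 8 * K * Real.sqrt (Real.log p / m))) := by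
  have hbound : ∀ j, 1 ≤ j → j ≤ p → k ≤ eigval H j ∧ eigval H j ≤ K := by
    intro j h₁ h₂
    obtain ⟨v, hv, hvj⟩ := exists_eigval_eq_inner hH h₁ h₂
    have hlow := hHk v
    have hup := real_inner_le_norm (H v) v
    have := hHK v
    rw [hv] at hlow hup this
    rw [hvj]
    constructor <;> linarith
  obtain ⟨hp₁, hp₂⟩ := hbound p (by omega) le_rfl
  obtain ⟨hr₁, hr₂⟩ := hbound (r + 1) (by omega) hr
  exact abs_sub_le_of_eigenvalue_bounds hc (hk.trans_le (hp₁.trans hp₂)) hk (Real.sqrt_nonneg _)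
    (by rwa [abs_of_pos (hk.trans_le hp₁)]) hr₁ hr₂ (abs_eigval_sub_le hT hH h (by omega) le_rfl)
    (abs_eigval_sub_le hT hH h (by omega) hr) hlt

theorem inner_subHessian_sub (hm : 0 < m) {f : Fin n → Param p → ℝ}
    (hf : ∀ i, IsQuadratic (f i)) (s : Fin m → Fin n) (θ θ' v : Param p) :
    inner ℝ v ((subHessian f s θ - hessian (objective f) θ') v) = (m : ℝ)⁻¹ *
      inner ℝ v ((∑ l, centered (fun i => (hessian (f i) θ' : Param p →ₗ[ℝ] Param p)) (s l)) v) := by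
  have hm' : (m : ℝ) ≠ 0 := by positivity
  have hcongr : ∀ j, hessian (f (s j)) θ = hessian (f (s j)) θ' := fun j =>
    (hf (s j)).hessian_eq_hessian θ θ'
  rw [hessian_objective hf, ← real_inner_smul_right]
  congr 1
  simp only [subHessian, centered, hcongr, Finset.sum_sub_distrib, Finset.sum_const,
    Finset.card_univ, Fintype.card_fin, ← Nat.cast_smul_eq_nsmul ℝ]
  simp [smul_sub, smul_smul, hm']

end NewSamp

open NewSamp in
theorem theorem3 (c : ℝ) (hc : 0 < c) :
    ∃ c₁ c₂ : ℝ, 0 < c₁ ∧ 0 < c₂ ∧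
      ∀ (p n r : ℕ) (_ : r < p)
        (f : Fin n → Param p → ℝ) (_ : ∀ i, IsQuadratic (f i))
        (C : Set (Param p)) (_ : Convex ℝ C) (_ : IsClosed C)
        (θstar : Param p) (_ : θstar ∈ C) (_ : IsMinOn (objective f) C θstar)
        (K : ℝ) (_ : ∀ i, ∀ θ ∈ C, ‖hessian (f i) θ‖ ≤ K)
        (k : ℝ) (_ : 0 < k)
        (_ : ∀ v, k * ‖v‖ ^ 2 ≤ inner ℝ (hessian (objective f) θstar v) v)
        (Ω : Type*) (_ : MeasurableSpace Ω) (μ : MeasureTheory.Measure Ω)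
        (_ : MeasureTheory.IsProbabilityMeasure μ)
        (mode : Sampling) (m : ℕ → ℕ) (_ : ∀ t, 0 < m t)
        (S : (t : ℕ) → Ω → Fin (m t) → Fin n) (_ : IndependentSubsampling μ mode S)
        (θ₀ : Param p) (η : ℕ → ℝ) (t : ℕ) (_ : η t = 1)
        (_ : c₂ * K * Real.sqrt (Real.log p / m t) < k),
        1 - 2 / (p : ℝ) ≤
          μ.real {ω |
            |xi c K (η t) r (m t)
                (subHessian f (S t ω) (iterate f C r η θ₀ (fun τ => S τ ω) t)) -
              xi c K (η t) r (m t) (hessian (objective f) θstar)| ≤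
            c₁ * K ^ 2 * Real.sqrt (Real.log p / m t) /
              (k * (k - c₂ * K * Real.sqrt (Real.log p / m t)))} := by

  -- The 8 is the Hoeffding constant; 16 + c collects two eigenvalue perturbations and the c-term.
  refine ⟨16 + c, 8, by positivity, by norm_num, ?_⟩
  intro p n r hr f hf C _ _ θstar hθ _ K hK k hk hHk Ω _ μ _ mode m hm S hS θ₀ η t hη hlt
  rw [hη]
  -- For p ≤ 2 the claimed probability bound is nonpositive.
  rcases Nat.lt_or_ge p 3 with hp | hp3
  · have hp0 : (0 : ℝ) < p := by exact_mod_cast (Nat.zero_le r).trans_lt hr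
    have hp2 : (p : ℝ) ≤ 2 := by exact_mod_cast Nat.lt_succ_iff.1 hp
    have : 1 ≤ 2 / (p : ℝ) := (one_le_div hp0).2 hp2
    exact le_trans (by linarith) MeasureTheory.measureReal_nonneg
  obtain ⟨ω₀⟩ := μ.nonempty_of_neZero
  have hn : 0 < n := Fin.pos (S t ω₀ ⟨0, hm t⟩)
  have hsymm : ∀ i θ, (hessian (f i) θ : Param p →ₗ[ℝ] Param p).IsSymmetric := fun i θ =>
    ((hf i).isSelfAdjoint_hessian θ).isSymmetric
  have hKi : ∀ i v, ‖hessian (f i) θstar v‖ ≤ K * ‖v‖ := fun i v =>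
    (hessian (f i) θstar).le_of_opNorm_le (hK i θstar hθ) v
  have hHsymm : (hessian (objective f) θstar : Param p →ₗ[ℝ] Param p).IsSymmetric := by
    rw [hessian_objective hf]
    simpa using isSymmetric_real_smul
      (isSymmetric_sum Finset.univ fun i => hsymm i θstar) (n : ℝ)⁻¹
  have hTsymm : ∀ (s : Fin (m t) → Fin n) θ,
      (subHessian f s θ : Param p →ₗ[ℝ] Param p).IsSymmetric := fun s θ => by
    simpa [subHessian] using isSymmetric_real_smul
      (isSymmetric_sum Finset.univ fun j => hsymm (s j) θ) (m t : ℝ)⁻¹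
  have hHK : ∀ v, ‖hessian (objective f) θstar v‖ ≤ K * ‖v‖ := fun v => by
    have hn' : (0 : ℝ) < n := by positivity
    rw [hessian_objective hf, smul_apply, sum_apply,
      norm_smul, Real.norm_of_nonneg (by positivity), inv_mul_le_iff₀ hn']
    refine (norm_sum_le_of_le _ fun i _ => hKi i v).trans (le_of_eq ?_)
    simp
  have hK0 : 0 < K := by
    let v : Param p := EuclideanSpace.single ⟨r, hr⟩ 1
    have hv : ‖v‖ = 1 := by simp [v]
    have h₁ := hHk v
    have h₂ := real_inner_le_norm (hessian (objective f) θstar v) v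
    have h₃ := hHK v
    rw [hv] at h₁ h₂ h₃
    linarith
  -- The bad event is expressed through Hessians at θstar, hence through the sample alone.
  let bad : Set (Fin (m t) → Fin n) := {s | ∃ v,
    8 * K * Real.sqrt (m t * Real.log p) * ‖v‖ ^ 2 < |inner ℝ v
      ((∑ l, centered (fun i => (hessian (f i) θstar : Param p →ₗ[ℝ] Param p)) (s l)) v)|}
  have hbad_le : μ.real (S t ⁻¹' bad) ≤ 1 / p := by
    rw [← MeasureTheory.map_measureReal_apply (hS.measurable t) bad.toFinite.measurableSet,
      hS.uniform t]
    exact real_uniformOn_le finrank_euclideanSpace_fin hn (hm t) hp3 (fun i => hsymm i θstar)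
      hK0 hKi mode
  have hcompl : 1 - 1 / (p : ℝ) ≤ μ.real (S t ⁻¹' bad)ᶜ := by
    rw [MeasureTheory.probReal_compl_eq_one_sub (hS.measurable t bad.toFinite.measurableSet)]
    linarith
  have hp12 : 1 / (p : ℝ) ≤ 2 / p := by gcongr; norm_num
  refine (show 1 - 2 / (p : ℝ) ≤ 1 - 1 / p by linarith).trans
    (hcompl.trans (MeasureTheory.measureReal_mono fun ω hω => ?_))
  refine abs_xi_sub_xi_le hr (hTsymm _ _) hHsymm hc hk hHK hHk hlt fun v => ?_
  have hv : |inner ℝ v ((∑ l, centered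
      (fun i => (hessian (f i) θstar : Param p →ₗ[ℝ] Param p)) (S t ω l)) v)| ≤
      8 * K * Real.sqrt (m t * Real.log p) * ‖v‖ ^ 2 := by
    by_contra! hlt'
    exact hω ⟨v, hlt'⟩
  have hmt : (0 : ℝ) < m t := by exact_mod_cast hm t
  have hsqrt : Real.sqrt (m t * Real.log p) = m t * Real.sqrt (Real.log p / m t) := by
    rw [show (m t : ℝ) * Real.log p = (m t : ℝ) ^ 2 * (Real.log p / m t) by field_simp,
      Real.sqrt_mul (by positivity), Real.sqrt_sq hmt.le]
  rw [inner_subHessian_sub (hm t) hf, abs_mul, abs_of_pos (inv_pos.2 hmt), inv_mul_le_iff₀ hmt]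
  rw [hsqrt] at hv
  linarith
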